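/- For $x_1,\dots,x_n\in[0,1]^d$ let the dispersion be $$\operatorname{disp}(x_1,\dots,x_n)=\sup\{\lambda_d(B) : B=I_1\times\dots\times I_d,\ I_k\subseteq[0,1]\text{ intervals},\ B\cap\{x_1,\dots,x_n\}=\emptyset\},$$ where $\lambda_d$ is the $d$-dimensional Lebesgue measure. Let $X_1,X_2,\dots$ be independent random variables, each uniformly distributed in $[0,1]^d$, and for $\varepsilon\in(0,1)$ and an integer $d\ge 1$ let $$N(\varepsilon,d)=\min\{n\in\mathbb N,\ n\ge 1 : \mathbb E\operatorname{disp}(X_1,\dots,X_n)\le\varepsilon\}.$$ This number depends only on $\varepsilon$ and $d$, not on the choice of the sequence or of the probability space. For all $\varepsilon\in\bigl(0,\tfrac1{9\mathrm e}\bigr)$ and all integers $d\ge1$ the minimum exists and $$\max\Bigl\{\frac1{9\varepsilon}\log\Bigl(\frac1{9\varepsilon}\Bigr),\ \frac{d}{2\mathrm e\,\varepsilon}\Bigr\}\ \le\ N(\varepsilon,d)\ \le\ \Bigl\lceil 9(1+\mathrm e^{-1})\,\frac d\varepsilon\,\log\Bigl(\frac{9(\mathrm e+1)}{\varepsilon}\Bigr)\Bigr\rceil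 .$$ In particular, for every fixed $\varepsilon\in\bigl(0,\tfrac1{9\mathrm e}\bigr)$, $N(\varepsilon,d)$ grows linearly in the dimension: $N(\varepsilon,d)=\Theta(d)$ as $d\to\infty$. -/

import Mathlib

open MeasureTheory ProbabilityTheory Asymptotics

/-- `B` is an axis-parallel box `I₁ × ⋯ × I_d` with intervals `I_k ⊆ [0,1]`; the intervals may be
open, closed, half-open or degenerate (order-connected subsets of `ℝ` are exactly the intervals). -/
def IsUnitBox {d : ℕ} (B : Set (Fin d → ℝ)) : Prop :=
  ∃ I : Fin d → Set ℝ,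
    (∀ k, (I k).OrdConnected ∧ I k ⊆ Set.Icc 0 1) ∧ B = Set.univ.pi I

/-- The dispersion of `x₁, …, x_n`: the supremum of the volumes of the axis-parallel boxes in
`[0,1]^d` that contain none of the points. (The set of volumes contains `0` and is bounded
by `1`, so the real supremum is the true one.) -/
noncomputable def dispersion {n d : ℕ} (x : Fin n → Fin d → ℝ) : ℝ :=
  sSup {v : ℝ | ∃ B : Set (Fin d → ℝ), IsUnitBox B ∧ (∀ i, x i ∉ B) ∧ v = volume.real B}

/-- The uniform distribution on the cube `[0,1]^d`. -/
noncomputable def uniformCube (d : ℕ) : Measure (Fin d → ℝ) :=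
  volume.restrict (Set.Icc 0 1)

/-- The expected dispersion of `n` independent points that are uniform in `[0,1]^d`,
as the integral of the dispersion against the joint law of the points. -/
noncomputable def expectedDispersion (n d : ℕ) : ℝ :=
  ∫ x : Fin n → Fin d → ℝ, dispersion x ∂(Measure.pi fun _ => uniformCube d)

/-- The inverse `N(ε,d)` of the expected dispersion: the least `n ≥ 1` for which the expected
dispersion of `n` points is at most `ε`. -/
noncomputable def invExpectedDispersion (ε : ℝ) (d : ℕ) : ℕ :=
  sInf {n : ℕ | 1 ≤ n ∧ expectedDispersion n d ≤ ε}

/-!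
If the dispersion exceeds `t`, then some box of volume larger than `t` contains none of the points.
After shrinking it to a grid of mesh `h` it still has volume at least `t - 2 * d * h`. Only few grid
boxes arise in this way: because `∑ (1 - ℓ_j) ≤ -log (∏ ℓ_j)` for the side lengths `ℓ_j`, the total
number of grid layers removed is at most `-log t / h`. For `t` proportional to `ε` and `h` to
`ε / d`, this number exceeds the number `2 * d` of faces only by a factor independent of `d`, so the
binomial number of candidates is at most exponential in `d`, without a factor `d ^ d`. The union
bound then gives the upper bound, linear in `d`.

For the lower bound by `d / ε`, cut off each point `x i` along its largest coordinate: this produces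
a box of volume `s ^ d * ∏ i, min (‖x i‖ / s) 1` that contains no point, and by independence the
expectation of this product factorizes. For the lower bound by `log (1 / ε) / ε`, split the cube
into about `1 / ε` equal slabs: with fewer points than a coupon collector needs, the second moment
method shows that one slab stays empty with probability bounded below.
-/

section Estimates

theorem choose_le_exp_one_mul_div_pow (n k : ℕ) :
    (n.choose k : ℝ) ≤ (Real.exp 1 * (n / k)) ^ k := by
  rcases k.eq_zero_or_pos with rfl | hk
  · simp
  have hexp : (k : ℝ) ^ k / k.factorial ≤ Real.exp 1 ^ k := by
    rw [← Real.exp_nat_mul, mul_one]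
    exact Real.pow_div_factorial_le_exp _ k.cast_nonneg k
  calc (n.choose k : ℝ) ≤ n ^ k / k.factorial := Nat.choose_le_pow_div k n
    _ = k ^ k / k.factorial * (n / k) ^ k := by rw [div_pow]; field_simp
    _ ≤ Real.exp 1 ^ k * (n / k) ^ k := by gcongr
    _ = (Real.exp 1 * (n / k)) ^ k := (mul_pow _ _ _).symm

theorem exp_neg_div_le_one_sub_inv_pow (n : ℕ) {m : ℝ} (hm : 1 < m) :
    Real.exp (-(n / (m - 1))) ≤ (1 - m⁻¹) ^ n := by
  have hpos : 0 < 1 - m⁻¹ := sub_pos.2 (inv_lt_one_of_one_lt₀ hm)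
  have hlog : -(m - 1)⁻¹ ≤ Real.log (1 - m⁻¹) := by
    convert! Real.one_sub_inv_le_log_of_pos hpos using 1
    have : m - 1 ≠ 0 := by linarith
    field_simp
    ring
  calc Real.exp (-(n / (m - 1))) = Real.exp (-(m - 1)⁻¹) ^ n := by
        rw [← Real.exp_nat_mul, mul_neg, div_eq_mul_inv]
    _ ≤ (1 - m⁻¹) ^ n := by
        gcongr
        exact (Real.le_log_iff_exp_le hpos).1 hlog

theorem prod_sub_prod_le_sum_sub {ι : Type*} (s : Finset ι) {f g : ι → ℝ}
    (hg : ∀ i ∈ s, 0 ≤ g i) (hgf : ∀ i ∈ s, g i ≤ f i) (hf : ∀ i ∈ s, f i ≤ 1) :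
    ∏ i ∈ s, f i - ∏ i ∈ s, g i ≤ ∑ i ∈ s, (f i - g i) := by
  induction s using Finset.cons_induction with
  | empty => simp
  | cons a s ha ih =>
    simp only [Finset.mem_cons, forall_eq_or_imp] at hg hgf hf
    have hG : ∏ i ∈ s, g i ≤ 1 :=
      Finset.prod_le_one hg.2 fun i hi => (hgf.2 i hi).trans (hf.2 i hi)
    have hGF : ∏ i ∈ s, g i ≤ ∏ i ∈ s, f i := Finset.prod_le_prod hg.2 hgf.2
    rw [Finset.prod_cons, Finset.prod_cons, Finset.sum_cons]
    calc f a * ∏ i ∈ s, f i - g a * ∏ i ∈ s, g i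
        = (f a - g a) * ∏ i ∈ s, g i + f a * (∏ i ∈ s, f i - ∏ i ∈ s, g i) := by ring
      _ ≤ (f a - g a) + (∏ i ∈ s, f i - ∏ i ∈ s, g i) :=
          add_le_add (mul_le_of_le_one_right (sub_nonneg.2 hgf.1) hG)
            (mul_le_of_le_one_left (sub_nonneg.2 hGF) hf.1)
      _ ≤ _ := by gcongr; exact ih hg.2 hgf.2 hf.2

theorem sum_one_sub_le_neg_log_prod {ι : Type*} (s : Finset ι) {f : ι → ℝ}
    (hf : ∀ i ∈ s, 0 < f i) : ∑ i ∈ s, (1 - f i) ≤ -Real.log (∏ i ∈ s, f i) := by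
  rw [Real.log_prod fun i hi => (hf i hi).ne', ← Finset.sum_neg_distrib]
  exact Finset.sum_le_sum fun i hi => by linarith [Real.log_le_sub_one_of_pos (hf i hi)]

theorem isTheta_natCast_of_le_of_le_natCeil {f : ℕ → ℕ} {c C : ℝ} (hc : 0 < c) (hC : 0 < C)
    (hlow : ∀ᶠ d : ℕ in Filter.atTop, c * d ≤ f d)
    (hup : ∀ᶠ d : ℕ in Filter.atTop, f d ≤ ⌈C * (d : ℝ)⌉₊) :
    (fun d : ℕ => (f d : ℝ)) =Θ[Filter.atTop] fun d : ℕ => (d : ℝ) := by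
  constructor
  · have hceil : (fun d : ℕ => (⌈C * (d : ℝ)⌉₊ : ℝ)) ~[Filter.atTop] fun d : ℕ => C * (d : ℝ) :=
      isEquivalent_nat_ceil.comp_tendsto (tendsto_natCast_atTop_atTop.const_mul_atTop hC)
    refine (IsBigO.of_norm_eventuallyLE ?_).trans (hceil.isBigO.trans (isBigO_const_mul_self C _ _))
    filter_upwards [hup] with d hd
    simpa using hd
  · refine IsBigO.of_bound c⁻¹ ?_
    filter_upwards [hlow] with d hd
    rw [Real.norm_natCast, Real.norm_natCast, inv_mul_eq_div, le_div_iff₀' hc]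
    exact hd

end Estimates

section Probability

variable {Ω ι : Type*} [MeasurableSpace Ω] {μ : Measure Ω}

theorem integral_le_add_measureReal_lt [IsProbabilityMeasure μ] {f : Ω → ℝ} (hf : Measurable f)
    (hf01 : ∀ ω, f ω ∈ Set.Icc 0 1) {t : ℝ} (ht : 0 ≤ t) :
    ∫ ω, f ω ∂μ ≤ t + μ.real {ω | t < f ω} := by
  have hmeas : MeasurableSet {ω | t < f ω} := measurableSet_lt measurable_const hf
  have hind : Integrable ({ω | t < f ω}.indicator (1 : Ω → ℝ)) μ :=
    (integrable_const (1 : ℝ)).indicator hmeas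
  calc ∫ ω, f ω ∂μ ≤ ∫ ω, (t + {ω | t < f ω}.indicator 1 ω) ∂μ := by
        refine integral_mono_of_nonneg (.of_forall fun ω => (hf01 ω).1)
          ((integrable_const t).add hind) (.of_forall fun ω => ?_)
        by_cases h : t < f ω
        · simpa [h] using (hf01 ω).2.trans (le_add_of_nonneg_left ht)
        · simpa [h] using not_lt.1 h
    _ = t + μ.real {ω | t < f ω} := by
        rw [integral_add (integrable_const t) hind, integral_indicator_one hmeas]
        simp

theorem one_sub_div_le_integral_of_measureReal_lt_le [IsProbabilityMeasure μ] {f : Ω → ℝ}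
    (hf : Integrable f μ) (hf01 : ∀ ω, f ω ∈ Set.Icc 0 1) {c : ℝ} {d : ℕ}
    (hc : ∀ t ∈ Set.Ioc (0 : ℝ) 1, μ.real {ω | f ω < t} ≤ c * t ^ d) :
    1 - c / (d + 1) ≤ ∫ ω, f ω ∂μ := by
  have htail : ∀ t ∈ Set.Ioc (0 : ℝ) 1, 1 - c * t ^ d ≤ μ.real {ω | t ≤ f ω} := by
    intro t ht
    have hcover : {ω | f ω < t} ∪ {ω | t ≤ f ω} = Set.univ :=
      Set.eq_univ_of_forall fun ω => lt_or_ge (f ω) t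
    have hunion := measureReal_union_le (μ := μ) {ω | f ω < t} {ω | t ≤ f ω}
    rw [hcover, probReal_univ] at hunion
    linarith [hc t ht]
  have hanti : Antitone fun t : ℝ => μ.real {ω | t ≤ f ω} :=
    fun t u htu => measureReal_mono fun ω hω => htu.trans hω
  calc 1 - c / (d + 1) = ∫ t in Set.Ioc (0 : ℝ) 1, (1 - c * t ^ d) := by
        rw [← intervalIntegral.integral_of_le zero_le_one, intervalIntegral.integral_sub
          intervalIntegrable_const (Continuous.intervalIntegrable (by fun_prop) _ _),
          intervalIntegral.integral_const_mul, integral_pow]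
        simp [div_eq_mul_inv]
    _ ≤ ∫ t in Set.Ioc (0 : ℝ) 1, μ.real {ω | t ≤ f ω} :=
        setIntegral_mono_on
          ((Continuous.integrableOn_Icc (by fun_prop)).mono_set Set.Ioc_subset_Icc_self)
          (((hanti.antitoneOn _).integrableOn_isCompact isCompact_Icc).mono_set
            Set.Ioc_subset_Icc_self)
          measurableSet_Ioc htail
    _ = ∫ ω, f ω ∂μ :=
        (hf.integral_eq_integral_Ioc_meas_le (.of_forall fun ω => (hf01 ω).1)
          (.of_forall fun ω => (hf01 ω).2)).symm

theorem measurableSet_forall_notMem [Countable ι] {S : Set Ω} (hS : MeasurableSet S) :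
    MeasurableSet {x : ι → Ω | ∀ i, x i ∉ S} := by
  have hpi : {x : ι → Ω | ∀ i, x i ∉ S} = ⋂ i, (fun x => x i) ⁻¹' Sᶜ := by ext; simp
  rw [hpi]
  exact .iInter fun i => measurable_pi_apply i hS.compl

variable [Fintype ι]

-- The Chung–Erdős inequality: with `Z = ∑ i, 1_{A i}` and `U = ⋃ i, A i`, the quadratic
-- polynomial `c ↦ ∫ (c * 1_U - Z) ^ 2` is nonnegative, so its discriminant is nonpositive.
theorem sq_sum_measureReal_le_measureReal_iUnion_mul [IsFiniteMeasure μ] {A : ι → Set Ω}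
    (hA : ∀ i, MeasurableSet (A i)) :
    (∑ i, μ.real (A i)) ^ 2 ≤ μ.real (⋃ i, A i) * ∑ i, ∑ j, μ.real (A i ∩ A j) := by
  have hint : ∀ {s : Set Ω}, MeasurableSet s → Integrable (s.indicator (1 : Ω → ℝ)) μ :=
    fun hs => (integrable_const (1 : ℝ)).indicator hs
  have hU : MeasurableSet (⋃ i, A i) := .iUnion hA
  have hZ : Integrable (fun ω => ∑ i, (A i).indicator (1 : Ω → ℝ) ω) μ :=
    integrable_finsetSum _ fun i _ => hint (hA i)
  have hZZ : ∀ i, Integrable (fun ω => ∑ j, (A i ∩ A j).indicator (1 : Ω → ℝ) ω) μ :=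
    fun i => integrable_finsetSum _ fun j _ => hint ((hA i).inter (hA j))
  have hUZ : ∀ c : ℝ, Integrable (fun ω => (⋃ i, A i).indicator (1 : Ω → ℝ) ω * (c * c) +
      (∑ i, (A i).indicator (1 : Ω → ℝ) ω) * (-2 * c)) μ :=
    fun c => ((hint hU).mul_const _).add (hZ.mul_const _)
  have hquad : ∀ c : ℝ, 0 ≤ μ.real (⋃ i, A i) * (c * c) + (-2 * ∑ i, μ.real (A i)) * c +
      ∑ i, ∑ j, μ.real (A i ∩ A j) := by
    intro c
    calc 0 ≤ ∫ ω, ((⋃ i, A i).indicator 1 ω * (c * c) + (∑ i, (A i).indicator 1 ω) * (-2 * c) +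
          ∑ i, ∑ j, (A i ∩ A j).indicator 1 ω) ∂μ := by
          refine integral_nonneg fun ω => ?_
          simp only [Set.inter_indicator_one, Pi.mul_apply, ← Finset.sum_mul_sum]
          by_cases hω : ∃ i, ω ∈ A i
          · rw [Set.indicator_of_mem (Set.mem_iUnion.2 hω), Pi.one_apply]
            exact (sq_nonneg (c - ∑ i, (A i).indicator 1 ω)).trans_eq (by ring)
          · simp [not_exists.1 hω]
      _ = _ := by
          rw [integral_add (hUZ c) (integrable_finsetSum _ fun i _ => hZZ i),
            integral_add ((hint hU).mul_const _) (hZ.mul_const _), integral_mul_const,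
            integral_mul_const, integral_finsetSum _ fun i _ => hint (hA i),
            integral_finsetSum _ fun i _ => hZZ i]
          simp only [integral_finsetSum _ fun j _ => hint ((hA _).inter (hA j)),
            integral_indicator_one hU, integral_indicator_one (hA _),
            integral_indicator_one ((hA _).inter (hA _))]
          ring
  have hdiscrim := discrim_le_zero hquad
  rw [discrim] at hdiscrim
  linarith

theorem sum_measureReal_le_measureReal_iUnion_mul_one_add [IsFiniteMeasure μ] {A : ι → Set Ω}
    (hA : ∀ i, MeasurableSet (A i))
    (hcorr : Pairwise fun i j => μ.real (A i ∩ A j) ≤ μ.real (A i) * μ.real (A j)) :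
    ∑ i, μ.real (A i) ≤ μ.real (⋃ i, A i) * (1 + ∑ i, μ.real (A i)) := by
  classical
  set z := ∑ i, μ.real (A i) with hz
  have hpair : ∀ i j, μ.real (A i ∩ A j) ≤
      (if i = j then μ.real (A i) else 0) + μ.real (A i) * μ.real (A j) := by
    intro i j
    rcases eq_or_ne i j with rfl | hij
    · simpa using mul_self_nonneg (μ.real (A i))
    · simpa [hij] using hcorr hij
  have hmoment : ∑ i, ∑ j, μ.real (A i ∩ A j) ≤ z + z ^ 2 := by
    calc ∑ i, ∑ j, μ.real (A i ∩ A j)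
        ≤ ∑ i, ∑ j, ((if i = j then μ.real (A i) else 0) + μ.real (A i) * μ.real (A j)) :=
          Finset.sum_le_sum fun i _ => Finset.sum_le_sum fun j _ => hpair i j
      _ = z + z ^ 2 := by
          simp only [Finset.sum_add_distrib, Finset.sum_ite_eq, Finset.mem_univ, if_true,
            ← Finset.sum_mul_sum, ← hz, sq]
  have hz0 : 0 ≤ z := Finset.sum_nonneg fun i _ => measureReal_nonneg
  rcases hz0.eq_or_lt with h0 | hpos
  · simp [← h0]
  refine le_of_mul_le_mul_left ?_ hpos
  calc z * z = z ^ 2 := (sq z).symm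
    _ ≤ μ.real (⋃ i, A i) * ∑ i, ∑ j, μ.real (A i ∩ A j) :=
        sq_sum_measureReal_le_measureReal_iUnion_mul hA
    _ ≤ μ.real (⋃ i, A i) * (z + z ^ 2) := by gcongr
    _ = z * (μ.real (⋃ i, A i) * (1 + z)) := by ring

variable [IsProbabilityMeasure μ] {S T : Set Ω}

theorem measureReal_pi_forall_notMem (hS : MeasurableSet S) :
    (Measure.pi fun _ : ι => μ).real {x | ∀ i, x i ∉ S} = (1 - μ.real S) ^ Fintype.card ι := by
  have hpi : {x : ι → Ω | ∀ i, x i ∉ S} = Set.univ.pi fun _ => Sᶜ := by ext; simp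
  rw [hpi, measureReal_def, Measure.pi_pi, ENNReal.toReal_prod, Finset.prod_const,
    Finset.card_univ, ← measureReal_def, probReal_compl_eq_one_sub hS]

theorem measureReal_pi_forall_notMem_inter_le (hS : MeasurableSet S) (hT : MeasurableSet T)
    (hST : Disjoint S T) :
    (Measure.pi fun _ : ι => μ).real ({x | ∀ i, x i ∉ S} ∩ {x | ∀ i, x i ∉ T}) ≤
      (Measure.pi fun _ : ι => μ).real {x | ∀ i, x i ∉ S} *
        (Measure.pi fun _ : ι => μ).real {x | ∀ i, x i ∉ T} := by
  have hinter : {x : ι → Ω | ∀ i, x i ∉ S} ∩ {x | ∀ i, x i ∉ T} = {x | ∀ i, x i ∉ S ∪ T} := by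
    ext x
    simp [forall_and]
  have hle : μ.real S + μ.real T ≤ 1 :=
    (measureReal_union hST hT).symm.trans_le measureReal_le_one
  rw [hinter, measureReal_pi_forall_notMem (hS.union hT), measureReal_pi_forall_notMem hS,
    measureReal_pi_forall_notMem hT, measureReal_union hST hT, ← mul_pow]
  refine pow_le_pow_left₀ (sub_nonneg.2 hle) ?_ _
  have hST0 : 0 ≤ μ.real S * μ.real T := mul_nonneg measureReal_nonneg measureReal_nonneg
  linarith

end Probability

section Boxes

theorem volume_real_univ_pi {ι : Type*} [Fintype ι] (I : ι → Set ℝ) :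
    volume.real (Set.univ.pi I) = ∏ j, volume.real (I j) := by
  simp only [measureReal_def, volume_pi_pi, ENNReal.toReal_prod]

theorem volume_real_eq_sSup_sub_sInf {I : Set ℝ} (hI : I.OrdConnected) (hb : BddBelow I)
    (ha : BddAbove I) : volume.real I = sSup I - sInf I := by
  rcases I.eq_empty_or_nonempty with rfl | hne
  · simp
  have hle : sInf I ≤ sSup I := csInf_le_csSup hne hb ha
  refine le_antisymm ?_ ?_
  · rw [← Real.volume_real_Icc_of_le hle]
    exact measureReal_mono (subset_Icc_csInf_csSup hb ha) measure_Icc_lt_top.ne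
  · rw [← Real.volume_real_Ioo_of_le hle]
    exact measureReal_mono
      (IsConnected.Ioo_csInf_csSup_subset ⟨hne, hI.isPreconnected⟩ hb ha)
      ((measure_mono (subset_Icc_csInf_csSup hb ha)).trans_lt measure_Icc_lt_top).ne

variable {d : ℕ} {B : Set (Fin d → ℝ)}

theorem uniformCube_real_of_subset (hB : B ⊆ Set.Icc 0 1) :
    (uniformCube d).real B = volume.real B := by
  rw [measureReal_def, uniformCube, Measure.restrict_eq_self _ hB, measureReal_def]

instance isProbabilityMeasure_uniformCube (d : ℕ) : IsProbabilityMeasure (uniformCube d) :=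
  ⟨by simp [uniformCube, Real.volume_Icc_pi]⟩

theorem IsUnitBox.subset_Icc (hB : IsUnitBox B) : B ⊆ Set.Icc 0 1 := by
  obtain ⟨I, hI, rfl⟩ := hB
  exact fun x hx => ⟨fun k => ((hI k).2 (hx k trivial)).1, fun k => ((hI k).2 (hx k trivial)).2⟩

theorem IsUnitBox.volume_real_le_one (hB : IsUnitBox B) : volume.real B ≤ 1 := by
  rw [← uniformCube_real_of_subset hB.subset_Icc]
  exact measureReal_le_one

theorem IsUnitBox.exists_endpoints (hB : IsUnitBox B) (hpos : 0 < volume.real B) :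
    ∃ a b : Fin d → ℝ, (∀ j, 0 ≤ a j ∧ a j < b j ∧ b j ≤ 1) ∧
      (Set.univ.pi fun j => Set.Ioo (a j) (b j)) ⊆ B ∧ volume.real B = ∏ j, (b j - a j) := by
  obtain ⟨I, hI, rfl⟩ := hB
  have hbb : ∀ j, BddBelow (I j) := fun j => bddBelow_Icc.mono (hI j).2
  have hba : ∀ j, BddAbove (I j) := fun j => bddAbove_Icc.mono (hI j).2
  have hvol : ∀ j, volume.real (I j) = sSup (I j) - sInf (I j) := fun j =>
    volume_real_eq_sSup_sub_sInf (hI j).1 (hbb j) (hba j)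
  rw [volume_real_univ_pi] at hpos ⊢
  have hIpos : ∀ j, 0 < volume.real (I j) := fun j =>
    measureReal_nonneg.lt_of_ne' (Finset.prod_ne_zero_iff.1 hpos.ne' j (Finset.mem_univ j))
  have hne : ∀ j, (I j).Nonempty := fun j =>
    Set.nonempty_iff_ne_empty.2 fun h => (hIpos j).ne' (by rw [h, measureReal_empty])
  refine ⟨fun j => sInf (I j), fun j => sSup (I j), fun j => ⟨?_, ?_, ?_⟩, ?_, ?_⟩
  · exact le_csInf (hne j) fun x hx => ((hI j).2 hx).1
  · exact sub_pos.1 ((hIpos j).trans_eq (hvol j))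
  · exact csSup_le (hne j) fun x hx => ((hI j).2 hx).2
  · exact Set.pi_mono fun j _ =>
      IsConnected.Ioo_csInf_csSup_subset ⟨hne j, (hI j).1.isPreconnected⟩ (hbb j) (hba j)
  · exact Finset.prod_congr rfl fun j _ => hvol j

/-- The slab of the unit cube in which the `l`-th coordinate is restricted to `I`. -/
def unitSlab (l : Fin d) (I : Set ℝ) : Set (Fin d → ℝ) :=
  Set.univ.pi (Function.update (fun _ => Set.Icc 0 1) l I)

theorem isUnitBox_unitSlab (l : Fin d) {I : Set ℝ} (hI : I.OrdConnected)
    (hI01 : I ⊆ Set.Icc 0 1) : IsUnitBox (unitSlab l I) := by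
  refine ⟨_, fun k => ?_, rfl⟩
  rcases eq_or_ne k l with rfl | hk
  · simpa using ⟨hI, hI01⟩
  · simpa [hk] using Set.ordConnected_Icc

theorem volume_real_unitSlab (l : Fin d) (I : Set ℝ) :
    volume.real (unitSlab l I) = volume.real I := by
  rw [unitSlab, volume_real_univ_pi, Finset.prod_eq_single l]
  · simp
  · intro k _ hk
    simp [hk]
  · simp

theorem measurableSet_unitSlab (l : Fin d) {I : Set ℝ} (hI : MeasurableSet I) :
    MeasurableSet (unitSlab l I) := by
  refine .univ_pi fun k => ?_
  rcases eq_or_ne k l with rfl | hk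
  · simpa using hI
  · simp [hk]

theorem disjoint_unitSlab (l : Fin d) {I J : Set ℝ} (hIJ : Disjoint I J) :
    Disjoint (unitSlab l I) (unitSlab l J) :=
  Set.disjoint_univ_pi.2 ⟨l, by simpa using hIJ⟩

/-- The closed box cut out of the unit cube by removing `k (inl j) + 1` layers of width `h` at the
lower end and `k (inr j) + 1` layers at the upper end of the `j`-th coordinate. Every box contains
a grid box of almost the same volume; the `+ 1` leaves room for the unknown position of the
endpoints between two multiples of `h`. -/
def gridBox (h : ℝ) (k : Fin d ⊕ Fin d → ℕ) : Set (Fin d → ℝ) :=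
  Set.univ.pi fun j => Set.Icc ((k (.inl j) + 1) * h) (1 - (k (.inr j) + 1) * h)

theorem isUnitBox_gridBox {h : ℝ} (hh : 0 ≤ h) (k : Fin d ⊕ Fin d → ℕ) :
    IsUnitBox (gridBox h k) :=
  ⟨_, fun j => ⟨Set.ordConnected_Icc, Set.Icc_subset_Icc (by positivity)
    (sub_le_self _ (by positivity))⟩, rfl⟩

theorem isClosed_gridBox (h : ℝ) (k : Fin d ⊕ Fin d → ℕ) : IsClosed (gridBox h k) :=
  isClosed_set_pi fun _ _ => isClosed_Icc

theorem IsUnitBox.exists_gridBox_subset (hB : IsUnitBox B) (hpos : 0 < volume.real B) {h : ℝ}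
    (hh : 0 < h) : ∃ k, gridBox h k ⊆ B ∧ volume.real B - d * (2 * h) ≤ volume.real (gridBox h k) ∧
      (∑ i, k i : ℕ) * h ≤ -Real.log (volume.real B) := by
  obtain ⟨a, b, hab, hsub, hvol⟩ := hB.exists_endpoints hpos
  have hfloor : ∀ y : ℝ, 0 ≤ y → ∃ m : ℕ, m * h ≤ y ∧ y < (m + 1) * h := fun y hy =>
    ⟨⌊y / h⌋₊, (le_div_iff₀ hh).1 (Nat.floor_le (div_nonneg hy hh.le)),
      (div_lt_iff₀ hh).1 (Nat.lt_floor_add_one _)⟩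
  choose p hp hp' using fun j => hfloor (a j) (hab j).1
  choose q hq hq' using fun j => hfloor (1 - b j) (sub_nonneg.2 (hab j).2.2)
  have hgrid : gridBox h (Sum.elim p q) =
      Set.univ.pi fun j => Set.Icc ((p j + 1) * h) (1 - (q j + 1) * h) := rfl
  refine ⟨Sum.elim p q, ?_, ?_, ?_⟩
  · rw [hgrid]
    exact (Set.pi_mono fun j _ =>
      Set.Icc_subset_Ioo (hp' j) (by linarith [hq' j])).trans hsub
  · rw [hgrid, volume_real_univ_pi, hvol, sub_le_comm]
    refine (prod_sub_prod_le_sum_sub _ (fun _ _ => measureReal_nonneg) (fun j _ => ?_)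
      fun j _ => ?_).trans ((Finset.sum_le_card_nsmul _ _ (2 * h) fun j _ => ?_).trans_eq ?_)
    · rw [Real.volume_real_Icc]
      exact max_le (by linarith [hp' j, hq' j]) (sub_nonneg.2 (hab j).2.1.le)
    · linarith [hab j]
    · rw [Real.volume_real_Icc]
      linarith [le_max_left (1 - (q j + 1) * h - (p j + 1) * h) 0, hp j, hq j]
    · simp
  · rw [hvol]
    refine le_trans ?_ (sum_one_sub_le_neg_log_prod _ fun j _ => sub_pos.2 (hab j).2.1)
    rw [Fintype.sum_sum_type, ← Finset.sum_add_distrib, Nat.cast_sum, Finset.sum_mul]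
    refine Finset.sum_le_sum fun j _ => ?_
    push_cast [Sum.elim_inl, Sum.elim_inr]
    linarith [hp j, hq j]

end Boxes

section Dispersion

variable {n d : ℕ} {x : Fin n → Fin d → ℝ}

theorem volume_real_le_dispersion {B : Set (Fin d → ℝ)} (hB : IsUnitBox B) (hx : ∀ i, x i ∉ B) :
    volume.real B ≤ dispersion x := by
  refine le_csSup ⟨1, ?_⟩ ⟨B, hB, hx, rfl⟩
  rintro v ⟨C, hC, -, rfl⟩
  exact hC.volume_real_le_one

theorem exists_isUnitBox_of_lt_dispersion {t : ℝ} (ht : 0 ≤ t) (h : t < dispersion x) :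
    ∃ B : Set (Fin d → ℝ), IsUnitBox B ∧ (∀ i, x i ∉ B) ∧ t < volume.real B := by
  by_contra! hle
  refine h.not_ge (Real.sSup_le ?_ ht)
  rintro v ⟨B, hB, hx, rfl⟩
  exact hle B hB hx

theorem dispersion_mem_Icc (x : Fin n → Fin d → ℝ) : dispersion x ∈ Set.Icc 0 1 := by
  constructor
  · refine Real.sSup_nonneg ?_
    rintro v ⟨B, -, -, rfl⟩
    exact measureReal_nonneg
  · refine Real.sSup_le ?_ zero_le_one
    rintro v ⟨B, hB, -, rfl⟩
    exact hB.volume_real_le_one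

-- A box missing all points contains a closed box of almost the same volume, which still misses
-- all points after a small perturbation.
theorem lowerSemicontinuous_dispersion (n d : ℕ) :
    LowerSemicontinuous (dispersion : (Fin n → Fin d → ℝ) → ℝ) := by
  intro x t ht
  rcases lt_or_ge t 0 with hneg | hnonneg
  · exact .of_forall fun y => hneg.trans_le (dispersion_mem_Icc y).1
  obtain ⟨B, hB, hx, htB⟩ := exists_isUnitBox_of_lt_dispersion hnonneg ht
  obtain ⟨h, hh, hdh⟩ := exists_pos_mul_lt (sub_pos.2 htB) (d * 2)
  obtain ⟨k, hkB, hkvol, -⟩ := hB.exists_gridBox_subset (hnonneg.trans_lt htB) hh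
  have hmiss : ∀ᶠ y : Fin n → Fin d → ℝ in nhds x, ∀ i, y i ∈ (gridBox h k)ᶜ :=
    Filter.eventually_all.2 fun i => (continuous_apply i).continuousAt.eventually_mem
      ((isClosed_gridBox h k).isOpen_compl.mem_nhds fun hi => hx i (hkB hi))
  filter_upwards [hmiss] with y hy
  calc t < volume.real B - d * (2 * h) := by linarith
    _ ≤ volume.real (gridBox h k) := hkvol
    _ ≤ dispersion y := volume_real_le_dispersion (isUnitBox_gridBox hh.le k) hy

theorem measurable_dispersion (n d : ℕ) : Measurable (dispersion : (Fin n → Fin d → ℝ) → ℝ) :=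
  (lowerSemicontinuous_dispersion n d).measurable

theorem integrable_dispersion (μ : Measure (Fin n → Fin d → ℝ)) [IsFiniteMeasure μ] :
    Integrable dispersion μ :=
  .of_mem_Icc 0 1 (measurable_dispersion n d).aemeasurable (.of_forall dispersion_mem_Icc)

variable {Ω : Type*} [MeasurableSpace Ω] {P : Measure Ω} {X : ℕ → Ω → Fin d → ℝ}

theorem integrable_dispersion_of_iIndepFun (hX : iIndepFun X P)
    (hlaw : ∀ i, HasLaw (X i) (uniformCube d) P) (n : ℕ) :
    Integrable (fun ω => dispersion fun i : Fin n => X i ω) P := by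
  have hXn := (hX.precomp Fin.val_injective).hasLaw_pi fun i : Fin n => hlaw i
  exact (hXn.map_eq ▸ integrable_dispersion _ : Integrable dispersion _).comp_aemeasurable
    hXn.aemeasurable

theorem integral_dispersion_of_iIndepFun (hX : iIndepFun X P)
    (hlaw : ∀ i, HasLaw (X i) (uniformCube d) P) (n : ℕ) :
    ∫ ω, dispersion (fun i : Fin n => X i ω) ∂P = expectedDispersion n d :=
  ((hX.precomp Fin.val_injective).hasLaw_pi fun i : Fin n => hlaw i).integral_comp
    (measurable_dispersion n d).aestronglyMeasurable

end Dispersion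

section LinearLowerBound

variable {n d : ℕ}

-- Each point `x i` is cut off along the single coordinate `J i`: the box with side lengths
-- `s * ∏ i with J i = j, r i` contains none of the points.
theorem pow_mul_prod_le_dispersion {x : Fin n → Fin d → ℝ} (J : Fin n → Fin d) {s : ℝ}
    {r : Fin n → ℝ} (hs : s ∈ Set.Icc 0 1) (hr : ∀ i, r i ∈ Set.Icc 0 1)
    (hx : ∀ i, s * r i ≤ |x i (J i)|) : s ^ d * ∏ i, r i ≤ dispersion x := by
  set b : Fin d → ℝ := fun j => s * ∏ i with J i = j, r i with hb
  have hprod0 : ∀ t : Finset (Fin n), 0 ≤ ∏ i ∈ t, r i :=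
    fun t => Finset.prod_nonneg fun i _ => (hr i).1
  have hprod1 : ∀ t : Finset (Fin n), ∏ i ∈ t, r i ≤ 1 :=
    fun t => Finset.prod_le_one (fun i _ => (hr i).1) fun i _ => (hr i).2
  have hb0 : ∀ j, 0 ≤ b j := fun j => mul_nonneg hs.1 (hprod0 _)
  have hbJ : ∀ i, b (J i) ≤ |x i (J i)| := by
    intro i
    have hi : i ∈ ({i' | J i' = J i} : Finset (Fin n)) := by simp
    refine le_trans (mul_le_mul_of_nonneg_left ?_ hs.1) (hx i)
    rw [← Finset.mul_prod_erase _ _ hi]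
    exact mul_le_of_le_one_right (hr i).1 (hprod1 _)
  calc s ^ d * ∏ i, r i = volume.real (Set.univ.pi fun j => Set.Ico 0 (b j)) := by
        simp only [volume_real_univ_pi, Real.volume_real_Ico_of_le (hb0 _), sub_zero]
        rw [hb, Finset.prod_mul_distrib, Finset.prod_const, Finset.card_univ, Fintype.card_fin,
          Finset.prod_fiberwise]
    _ ≤ dispersion x := by
        refine volume_real_le_dispersion ⟨_, fun j => ⟨Set.ordConnected_Ico, ?_⟩, rfl⟩
          fun i hi => ?_
        · exact Set.Ico_subset_Icc_self.trans
            (Set.Icc_subset_Icc le_rfl (mul_le_one₀ hs.2 (hprod0 _) (hprod1 _)))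
        · obtain ⟨hnonneg, hlt⟩ := hi (J i) trivial
          exact hlt.not_ge ((hbJ i).trans_eq (abs_of_nonneg hnonneg))

theorem exists_norm_apply_eq_norm {ι : Type*} [Fintype ι] [Nonempty ι] (x : ι → ℝ) :
    ∃ j, ‖x j‖ = ‖x‖ := by
  obtain ⟨j, hj⟩ := Finite.exists_max fun j => ‖x j‖
  exact ⟨j, le_antisymm (norm_le_pi_norm x j) ((pi_norm_le_iff_of_nonempty x).2 hj)⟩

theorem uniformCube_real_norm_lt_le {r : ℝ} (hr : 0 ≤ r) :
    (uniformCube d).real {x | ‖x‖ < r} ≤ r ^ d := by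
  have hsub : {x : Fin d → ℝ | ‖x‖ < r} ∩ Set.Icc 0 1 ⊆ Set.univ.pi fun _ => Set.Icc 0 r := by
    rintro x ⟨hx, hx0, -⟩ j -
    exact ⟨hx0 j, (Real.le_norm_self _).trans ((norm_le_pi_norm x j).trans hx.le)⟩
  calc (uniformCube d).real {x | ‖x‖ < r}
      = volume.real ({x : Fin d → ℝ | ‖x‖ < r} ∩ Set.Icc 0 1) :=
        measureReal_restrict_apply (measurableSet_lt measurable_norm measurable_const)
    _ ≤ volume.real (Set.univ.pi fun _ : Fin d => Set.Icc 0 r) :=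
        measureReal_mono hsub (isCompact_univ_pi fun _ => isCompact_Icc).measure_lt_top.ne
    _ = r ^ d := by
        rw [volume_real_univ_pi, Real.volume_real_Icc_of_le hr]
        simp

theorem one_sub_div_le_integral_min_norm_div {s : ℝ} (hs : 0 < s) :
    1 - s ^ d / (d + 1) ≤ ∫ x, min (‖x‖ / s) 1 ∂uniformCube d := by
  have h01 : ∀ x : Fin d → ℝ, min (‖x‖ / s) 1 ∈ Set.Icc 0 1 :=
    fun x => ⟨by positivity, min_le_right _ _⟩
  refine one_sub_div_le_integral_of_measureReal_lt_le
    (.of_mem_Icc 0 1 (by fun_prop) (.of_forall h01)) h01 fun t ht => ?_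
  have hset : {x : Fin d → ℝ | min (‖x‖ / s) 1 < t} = {x | ‖x‖ < s * t} := by
    ext x
    simp only [Set.mem_ofPred_eq, min_lt_iff, ht.2.not_gt, or_false, div_lt_iff₀' hs]
  rw [hset, ← mul_pow]
  exact uniformCube_real_norm_lt_le (mul_pos hs ht.1).le

theorem mul_one_sub_pow_le_expectedDispersion (hd : 1 ≤ d) {v : ℝ} (hv : 0 < v) (hv1 : v ≤ 1) :
    v * (1 - v / (d + 1)) ^ n ≤ expectedDispersion n d := by
  have : NeZero d := ⟨by lia⟩
  obtain ⟨s, hs, hsd⟩ : ∃ s : ℝ, 0 < s ∧ s ^ d = v :=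
    ⟨v ^ (d⁻¹ : ℝ), Real.rpow_pos_of_pos hv _, Real.rpow_inv_natCast_pow hv.le (NeZero.ne d)⟩
  have hs1 : s ≤ 1 := (pow_le_one_iff_of_nonneg hs.le (NeZero.ne d)).1 (hsd.trans_le hv1)
  have hpoint : ∀ x : Fin n → Fin d → ℝ, v * ∏ i, min (‖x i‖ / s) 1 ≤ dispersion x := by
    intro x
    choose J hJ using fun i => exists_norm_apply_eq_norm (x i)
    rw [← hsd]
    refine pow_mul_prod_le_dispersion J ⟨hs.le, hs1⟩
      (fun i => ⟨by positivity, min_le_right _ _⟩) fun i => ?_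
    rw [← Real.norm_eq_abs, hJ, ← le_div_iff₀' hs]
    exact min_le_left _ _
  have hbase : 0 ≤ 1 - v / (d + 1) :=
    sub_nonneg.2 ((div_le_self hv.le (by simp)).trans hv1)
  calc v * (1 - v / (d + 1)) ^ n
      ≤ v * (∫ x, min (‖x‖ / s) 1 ∂uniformCube d) ^ n := by
        gcongr
        exact hsd ▸ one_sub_div_le_integral_min_norm_div hs
    _ = ∫ x : Fin n → Fin d → ℝ, v * ∏ i, min (‖x i‖ / s) 1 ∂Measure.pi fun _ => uniformCube d := by
        rw [integral_const_mul, integral_fintype_prod_eq_pow fun x : Fin d → ℝ => min (‖x‖ / s) 1,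
          Fintype.card_fin]
    _ ≤ expectedDispersion n d :=
        integral_mono_of_nonneg (.of_forall fun x => by positivity) (integrable_dispersion _)
          (.of_forall hpoint)

theorem exp_neg_div_le_expectedDispersion (hd : 1 ≤ d) :
    Real.exp (-(n / d)) ≤ expectedDispersion n d := by
  have hd' : (0 : ℝ) < d := by exact_mod_cast hd
  have hpow := exp_neg_div_le_one_sub_inv_pow n (lt_add_of_pos_left (1 : ℝ) hd')
  rw [add_sub_cancel_right] at hpow
  refine hpow.trans ?_
  simpa using mul_one_sub_pow_le_expectedDispersion (n := n) hd one_pos le_rfl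

theorem div_le_expectedDispersion (hd : 1 ≤ d) (hdn : d ≤ n) :
    d / (Real.exp 1 * n) ≤ expectedDispersion n d := by
  have hd' : (0 : ℝ) < d := by exact_mod_cast hd
  have hdn' : (d : ℝ) ≤ n := by exact_mod_cast hdn
  have hn' : (0 : ℝ) < n := hd'.trans_le hdn'
  have hpow := exp_neg_div_le_one_sub_inv_pow n (lt_add_of_pos_left (1 : ℝ) hn')
  rw [add_sub_cancel_right, div_self hn'.ne'] at hpow
  calc d / (Real.exp 1 * n) = d / n * Real.exp (-1) := by
        rw [Real.exp_neg]
        field_simp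
    _ ≤ (d + 1) / (n + 1) * (1 - (n + 1 : ℝ)⁻¹) ^ n := by
        gcongr ?_ * ?_
        rw [div_le_div_iff₀ hn' (by positivity)]
        linarith
    _ = (d + 1) / (n + 1) * (1 - (d + 1) / (n + 1) / (d + 1)) ^ n := by
        rw [div_div_cancel_left' (by positivity)]
    _ ≤ expectedDispersion n d :=
        mul_one_sub_pow_le_expectedDispersion hd (by positivity)
          ((div_le_one (by positivity)).2 (by linarith))

theorem div_exp_one_mul_le_of_expectedDispersion_le {ε : ℝ} (hε : 0 < ε)
    (hε' : ε < Real.exp (-1)) (hd : 1 ≤ d) (hE : expectedDispersion n d ≤ ε) :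
    d / (Real.exp 1 * ε) ≤ n := by
  have hd' : (0 : ℝ) < d := by exact_mod_cast hd
  have hdn : (d : ℝ) < n := by
    have hexp := (exp_neg_div_le_expectedDispersion hd).trans_lt (hE.trans_lt hε')
    rwa [Real.exp_lt_exp, neg_lt_neg_iff, one_lt_div hd'] at hexp
  have hdiv := (div_le_expectedDispersion hd (by exact_mod_cast hdn.le)).trans hE
  have hn' : (0 : ℝ) < n := hd'.trans hdn
  rw [div_le_iff₀ (by positivity)] at hdiv ⊢
  linarith

end LinearLowerBound

section LogarithmicLowerBound

variable {n d : ℕ}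

-- If `z` is the expected number of boxes missed by all points, then some box is missed with
-- probability at least `z / (1 + z)`; Markov's inequality turns this into a bound on the mean.
theorem mul_le_expectedDispersion_mul_of_pairwise_disjoint {ι : Type*} [Fintype ι]
    {B : ι → Set (Fin d → ℝ)} {v : ℝ} (hbox : ∀ i, IsUnitBox (B i))
    (hmeas : ∀ i, MeasurableSet (B i)) (hvol : ∀ i, volume.real (B i) = v)
    (hdisj : Pairwise fun i j => Disjoint (B i) (B j)) :
    v * (Fintype.card ι * (1 - v) ^ n) ≤
      expectedDispersion n d * (1 + Fintype.card ι * (1 - v) ^ n) := by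
  rcases isEmpty_or_nonempty ι with hι | ⟨⟨i₀⟩⟩
  · simpa [expectedDispersion] using integral_nonneg fun x => (dispersion_mem_Icc x).1
  set P : Measure (Fin n → Fin d → ℝ) := Measure.pi fun _ => uniformCube d
  set missed : ι → Set (Fin n → Fin d → ℝ) := fun i => {x | ∀ k, x k ∉ B i} with hmissed
  have hv : v ∈ Set.Icc 0 1 := hvol i₀ ▸ ⟨measureReal_nonneg, (hbox i₀).volume_real_le_one⟩
  have hsum : ∑ i, P.real (missed i) = Fintype.card ι * (1 - v) ^ n := by
    simp only [P, hmissed, measureReal_pi_forall_notMem (hmeas _), Fintype.card_fin,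
      uniformCube_real_of_subset (hbox _).subset_Icc, hvol, Finset.sum_const, Finset.card_univ,
      nsmul_eq_mul]
  have hunion := sum_measureReal_le_measureReal_iUnion_mul_one_add (μ := P) (A := missed)
    (fun i => measurableSet_forall_notMem (hmeas i)) fun i j hij =>
      measureReal_pi_forall_notMem_inter_le (hmeas i) (hmeas j) (hdisj hij)
  have hmarkov : v * P.real (⋃ i, missed i) ≤ expectedDispersion n d := by
    refine le_trans (mul_le_mul_of_nonneg_left (measureReal_mono ?_) hv.1)
      (mul_meas_ge_le_integral_of_nonneg (.of_forall fun x => (dispersion_mem_Icc x).1)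
        (integrable_dispersion P) v)
    exact Set.iUnion_subset fun i x hx =>
      (hvol i).symm.trans_le (volume_real_le_dispersion (hbox i) hx)
  rw [hsum] at hunion
  have hz : 0 ≤ 1 + Fintype.card ι * (1 - v) ^ n := by
    have := sub_nonneg.2 hv.2
    positivity
  calc v * (Fintype.card ι * (1 - v) ^ n)
      ≤ v * (P.real (⋃ i, missed i) * (1 + Fintype.card ι * (1 - v) ^ n)) :=
        mul_le_mul_of_nonneg_left hunion hv.1
    _ = v * P.real (⋃ i, missed i) * (1 + Fintype.card ι * (1 - v) ^ n) := (mul_assoc _ _ _).symm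
    _ ≤ expectedDispersion n d * (1 + Fintype.card ι * (1 - v) ^ n) := by gcongr

theorem exists_pairwise_disjoint_isUnitBox (l : Fin d) (m : ℕ) :
    ∃ B : Fin m → Set (Fin d → ℝ), (∀ j, IsUnitBox (B j)) ∧ (∀ j, MeasurableSet (B j)) ∧
      (∀ j, volume.real (B j) = (m : ℝ)⁻¹) ∧ Pairwise fun j k => Disjoint (B j) (B k) := by
  set cell : ℕ → Set ℝ := fun j => Set.Ico (j / m) ((j + 1 : ℕ) / m)
  have hcell : Pairwise fun j k => Disjoint (cell j) (cell k) :=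
    Monotone.pairwise_disjoint_on_Ico_succ (f := fun j : ℕ => (j / m : ℝ)) fun j k hjk => by
      dsimp only
      gcongr
  refine ⟨fun j => unitSlab l (cell j), fun j => ?_,
    fun j => measurableSet_unitSlab l measurableSet_Ico, fun j => ?_,
    fun j k hjk => disjoint_unitSlab l (hcell (Fin.val_ne_of_ne hjk))⟩
  · refine isUnitBox_unitSlab l Set.ordConnected_Ico
      (Set.Ico_subset_Icc_self.trans (Set.Icc_subset_Icc (by positivity) ?_))
    exact div_le_one_of_le₀ (by exact_mod_cast j.2) m.cast_nonneg
  · rw [volume_real_unitSlab, Real.volume_real_Ico_of_le (by gcongr; simp)]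
    push_cast
    ring

theorem one_div_add_inv_le_expectedDispersion (hd : 1 ≤ d) {m : ℕ} (hm : 1 < m) :
    1 / (m + ((1 - (m : ℝ)⁻¹) ^ n)⁻¹) ≤ expectedDispersion n d := by
  have hm' : (1 : ℝ) < m := by exact_mod_cast hm
  obtain ⟨B, hbox, hmeas, hvol, hdisj⟩ := exists_pairwise_disjoint_isUnitBox (⟨0, hd⟩ : Fin d) m
  have hE := mul_le_expectedDispersion_mul_of_pairwise_disjoint (n := n) hbox hmeas hvol hdisj
  have hq : 0 < (1 - (m : ℝ)⁻¹) ^ n := pow_pos (sub_pos.2 (inv_lt_one_of_one_lt₀ hm')) n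
  rw [Fintype.card_fin, inv_mul_cancel_left₀ (by positivity)] at hE
  refine (div_le_iff₀ (by positivity)).2 (le_of_mul_le_mul_right ?_ hq)
  calc 1 * (1 - (m : ℝ)⁻¹) ^ n ≤ expectedDispersion n d * (1 + m * (1 - (m : ℝ)⁻¹) ^ n) := by
        rwa [one_mul]
    _ = expectedDispersion n d * (m + ((1 - (m : ℝ)⁻¹) ^ n)⁻¹) * (1 - (m : ℝ)⁻¹) ^ n := by
        rw [mul_assoc, add_mul, inv_mul_cancel₀ hq.ne', add_comm]

theorem lt_expectedDispersion_of_lt_mul_log (hd : 1 ≤ d) {x : ℝ} (hx : 1 < x)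
    (hn : n < x * Real.log x) : 1 / (4 * x) < expectedDispersion n d := by
  have hx0 : 0 < x := one_pos.trans hx
  have hceil : x ≤ ⌈x⌉₊ := Nat.le_ceil x
  have hceil' : (⌈x⌉₊ : ℝ) < x + 1 := Nat.ceil_lt_add_one hx0.le
  have hm : (1 : ℝ) < (⌈x⌉₊ + 1 : ℕ) := by
    push_cast
    linarith
  have hinv : ((1 - ((⌈x⌉₊ + 1 : ℕ) : ℝ)⁻¹) ^ n)⁻¹ ≤ x := by
    refine inv_le_of_inv_le₀ hx0 (le_trans ?_ (exp_neg_div_le_one_sub_inv_pow n hm))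
    rw [← Real.exp_log hx0, ← Real.exp_neg, Real.exp_log hx0, Nat.cast_succ, add_sub_cancel_right]
    gcongr
    rw [div_le_iff₀' (hx0.trans_le hceil)]
    exact hn.le.trans (mul_le_mul_of_nonneg_right hceil (Real.log_pos hx).le)
  refine lt_of_lt_of_le ?_ (one_div_add_inv_le_expectedDispersion hd (by exact_mod_cast hm))
  refine one_div_lt_one_div_of_lt ?_ ?_
  · have := inv_nonneg.2 (pow_nonneg (sub_nonneg.2 (inv_le_one_of_one_le₀ hm.le)) n)
    positivity
  · push_cast at hinv ⊢
    linarith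

theorem mul_log_le_of_expectedDispersion_le {ε : ℝ} (hε : 0 < ε) (hd : 1 ≤ d)
    (hE : expectedDispersion n d ≤ ε) : 1 / (9 * ε) * Real.log (1 / (9 * ε)) ≤ n := by
  rcases le_or_gt (1 / (9 * ε)) 1 with hle | hlt
  · have hlog : Real.log (1 / (9 * ε)) ≤ 0 := Real.log_nonpos (by positivity) hle
    exact (mul_nonpos_of_nonneg_of_nonpos (by positivity) hlog).trans n.cast_nonneg
  · by_contra! hn
    refine (lt_expectedDispersion_of_lt_mul_log hd hlt hn).not_ge (hE.trans ?_)
    rw [le_div_iff₀ (by positivity)]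
    field_simp
    norm_num

end LogarithmicLowerBound

section UpperBound

-- The slack `M - ∑ i, k i` is recorded as an additional coordinate.
theorem exists_finset_forall_sum_le_mem (ι : Type*) [Fintype ι] (M : ℕ) :
    ∃ K : Finset (ι → ℕ), (∀ k : ι → ℕ, ∑ i, k i ≤ M → k ∈ K) ∧
      K.card ≤ (Fintype.card ι + M).choose (Fintype.card ι) := by
  classical
  refine ⟨((Finset.univ : Finset (Option ι)).finsuppAntidiag M).image fun f i => f (some i),
    fun k hk => ?_, Finset.card_image_le.trans_eq ?_⟩
  · refine Finset.mem_image.2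
      ⟨Finsupp.equivFunOnFinite.symm fun o => o.elim (M - ∑ i, k i) k, ?_, rfl⟩
    simp only [Finset.mem_finsuppAntidiag, Finset.subset_univ, and_true, Fintype.sum_option,
      Finsupp.coe_equivFunOnFinite_symm, Option.elim]
    exact Nat.sub_add_cancel hk
  · rw [Finset.card_finsuppAntidiag_nat_eq_choose, Finset.card_univ, Fintype.card_option,
      add_right_comm, Nat.add_sub_cancel, Nat.choose_symm_add]

variable {n d : ℕ}

-- The union bound over the grid boxes of volume at least `t - d * (2 * h)`.
theorem measureReal_lt_dispersion_le {t h : ℝ} (ht : 0 < t) (hh : 0 < h) :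
    (Measure.pi fun _ : Fin n => uniformCube d).real {x | t < dispersion x} ≤
      (2 * d + ⌊-Real.log t / h⌋₊).choose (2 * d) * Real.exp (-(n * (t - d * (2 * h)))) := by
  obtain ⟨K, hK, hcard⟩ := exists_finset_forall_sum_le_mem (Fin d ⊕ Fin d) ⌊-Real.log t / h⌋₊
  rw [Fintype.card_sum, Fintype.card_fin, ← two_mul] at hcard
  set large : Finset (Fin d ⊕ Fin d → ℕ) :=
    K.filter fun k => t - d * (2 * h) ≤ volume.real (gridBox h k)
  have hcover : {x : Fin n → Fin d → ℝ | t < dispersion x} ⊆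
      ⋃ k ∈ large, {x | ∀ i, x i ∉ gridBox h k} := by
    intro x hx
    obtain ⟨B, hB, hxB, htB⟩ := exists_isUnitBox_of_lt_dispersion ht.le hx
    obtain ⟨k, hkB, hkvol, hksum⟩ := hB.exists_gridBox_subset (ht.trans htB) hh
    have hkM : ∑ i, k i ≤ ⌊-Real.log t / h⌋₊ :=
      Nat.le_floor ((le_div_iff₀ hh).2 (hksum.trans (by gcongr)))
    refine Set.mem_biUnion (x := k) ?_ fun i hi => hxB i (hkB hi)
    exact Finset.mem_filter.2 ⟨hK k hkM, (sub_le_sub_right htB.le _).trans hkvol⟩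
  have hmiss : ∀ k ∈ large, (Measure.pi fun _ : Fin n => uniformCube d).real
      {x | ∀ i, x i ∉ gridBox h k} ≤ Real.exp (-(n * (t - d * (2 * h)))) := by
    intro k hk
    have hbox := isUnitBox_gridBox hh.le k
    rw [measureReal_pi_forall_notMem (isClosed_gridBox h k).measurableSet, Fintype.card_fin,
      uniformCube_real_of_subset hbox.subset_Icc, ← mul_neg, Real.exp_nat_mul]
    gcongr
    · exact sub_nonneg.2 hbox.volume_real_le_one
    · exact (Real.one_sub_le_exp_neg _).trans
        (Real.exp_le_exp.2 (neg_le_neg (Finset.mem_filter.1 hk).2))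
  calc (Measure.pi fun _ : Fin n => uniformCube d).real {x | t < dispersion x}
      ≤ (Measure.pi fun _ : Fin n => uniformCube d).real
          (⋃ k ∈ large, {x | ∀ i, x i ∉ gridBox h k}) :=
        measureReal_mono hcover (measure_ne_top _ _)
    _ ≤ large.card • Real.exp (-(n * (t - d * (2 * h)))) :=
        (measureReal_biUnion_finset_le _ _).trans (Finset.sum_le_card_nsmul _ _ _ hmiss)
    _ ≤ _ := by
        rw [nsmul_eq_mul]
        gcongr
        exact (Finset.card_filter_le _ _).trans hcard

theorem expectedDispersion_le_add {t h : ℝ} (ht : 0 < t) (hh : 0 < h) :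
    expectedDispersion n d ≤
      t + (2 * d + ⌊-Real.log t / h⌋₊).choose (2 * d) * Real.exp (-(n * (t - d * (2 * h)))) :=
  (integral_le_add_measureReal_lt (measurable_dispersion n d) dispersion_mem_Icc ht.le).trans
    (add_le_add_right (measureReal_lt_dispersion_le ht hh) t)

theorem choose_floor_neg_log_div_le (hd : 1 ≤ d) {ε : ℝ} (hε : 0 < ε) (hε1 : ε ≤ 1) :
    ((2 * d + ⌊-Real.log (3 * ε / 4) / (ε / (8 * d))⌋₊).choose (2 * d) : ℝ) ≤
      (4 / ε) ^ (4 * d) := by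
  have hlog0 : 0 ≤ -Real.log (3 * ε / 4) :=
    neg_nonneg.2 (Real.log_nonpos (by positivity) (by linarith))
  have hlog : -Real.log (3 * ε / 4) ≤ 4 / (3 * ε) - 1 := by
    have := Real.one_sub_inv_le_log_of_pos (show 0 < 3 * ε / 4 by positivity)
    rw [inv_div] at this
    linarith
  have hfloor : (⌊-Real.log (3 * ε / 4) / (ε / (8 * d))⌋₊ : ℝ) ≤
      (4 / (3 * ε) - 1) / (ε / (8 * d)) :=
    (Nat.floor_le (by positivity)).trans (by gcongr)
  refine (choose_le_exp_one_mul_div_pow _ _).trans ?_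
  rw [show 4 * d = 2 * (2 * d) by ring, pow_mul (4 / ε)]
  gcongr
  push_cast
  calc Real.exp 1 * ((2 * d + ⌊-Real.log (3 * ε / 4) / (ε / (8 * d))⌋₊) / (2 * d))
      ≤ 3 * ((2 * d + (4 / (3 * ε) - 1) / (ε / (8 * d))) / (2 * d)) := by
        gcongr
        exact Real.exp_one_lt_three.le
    _ = (4 / ε) ^ 2 - 3 * (4 - ε) / ε := by
        field_simp
        ring
    _ ≤ (4 / ε) ^ 2 := sub_le_self _ (div_nonneg (by linarith) hε.le)

theorem expectedDispersion_le_of_mul_log_le (hd : 1 ≤ d) {ε : ℝ} (hε : 0 < ε) (hε1 : ε ≤ 1)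
    (hn : 10 * (d / ε) * Real.log (4 / ε) ≤ n) : expectedDispersion n d ≤ ε := by
  have hexp : Real.exp (-(n * (3 * ε / 4 - d * (2 * (ε / (8 * d)))))) ≤ ((4 / ε) ^ (5 * d))⁻¹ := by
    rw [← Real.exp_log (show 0 < (4 / ε) ^ (5 * d) by positivity), ← Real.exp_neg, Real.log_pow]
    refine Real.exp_le_exp.2 (neg_le_neg ?_)
    calc ((5 * d : ℕ) : ℝ) * Real.log (4 / ε) = 10 * (d / ε) * Real.log (4 / ε) * (ε / 2) := by
          push_cast
          field_simp
          ring
      _ ≤ n * (ε / 2) := by gcongr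
      _ = n * (3 * ε / 4 - d * (2 * (ε / (8 * d)))) := by
          field_simp
          ring
  calc expectedDispersion n d
      ≤ 3 * ε / 4 + (2 * d + ⌊-Real.log (3 * ε / 4) / (ε / (8 * d))⌋₊).choose (2 * d) *
          Real.exp (-(n * (3 * ε / 4 - d * (2 * (ε / (8 * d)))))) :=
        expectedDispersion_le_add (by positivity) (by positivity)
    _ ≤ 3 * ε / 4 + (4 / ε) ^ (4 * d) * ((4 / ε) ^ (5 * d))⁻¹ := by
        gcongr
        exact choose_floor_neg_log_div_le hd hε hε1
    _ = 3 * ε / 4 + ((4 / ε) ^ d)⁻¹ := by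
        rw [show 5 * d = 4 * d + d by ring, pow_add]
        field_simp
    _ ≤ 3 * ε / 4 + (4 / ε)⁻¹ := by
        gcongr
        exact le_self_pow₀ ((one_le_div hε).2 (by linarith)) (by lia)
    _ = ε := by
        rw [inv_div]
        ring

theorem expectedDispersion_natCeil_le (hd : 1 ≤ d) {ε : ℝ} (hε : 0 < ε) (hε1 : ε ≤ 1) :
    expectedDispersion ⌈9 * (1 + Real.exp (-1)) * (d / ε) *
      Real.log (9 * (Real.exp 1 + 1) / ε)⌉₊ d ≤ ε := by
  refine expectedDispersion_le_of_mul_log_le hd hε hε1 (le_trans ?_ (Nat.le_ceil _))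
  have hinv : 1 / 9 ≤ Real.exp (-1) := by
    rw [Real.exp_neg, one_div]
    exact inv_anti₀ (Real.exp_pos 1) (by linarith [Real.exp_one_lt_three])
  have hlog : 0 ≤ Real.log (4 / ε) := Real.log_nonneg ((one_le_div hε).2 (by linarith))
  gcongr
  · linarith
  · linarith [Real.exp_pos 1]

end UpperBound

section InverseExpectedDispersion

theorem isLeast_invExpectedDispersion {ε : ℝ} {d n : ℕ} (hn : 1 ≤ n)
    (h : expectedDispersion n d ≤ ε) :
    IsLeast {n : ℕ | 1 ≤ n ∧ expectedDispersion n d ≤ ε} (invExpectedDispersion ε d) :=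
  ⟨Nat.sInf_mem ⟨n, hn, h⟩, fun _ hm => Nat.sInf_le hm⟩

theorem max_le_of_expectedDispersion_le {ε : ℝ} {n d : ℕ} (hε : ε ∈ Set.Ioo 0 (Real.exp (-1)))
    (hd : 1 ≤ d) (hE : expectedDispersion n d ≤ ε) :
    max (1 / (9 * ε) * Real.log (1 / (9 * ε))) (d / (2 * Real.exp 1 * ε)) ≤ n := by
  have hε0 := hε.1
  refine max_le (mul_log_le_of_expectedDispersion_le hε0 hd hE) (le_trans ?_
    (div_exp_one_mul_le_of_expectedDispersion_le hε0 hε.2 hd hE))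
  gcongr
  linarith [Real.exp_pos 1]

end InverseExpectedDispersion

theorem corollary1_general (ε : ℝ) (hε : ε ∈ Set.Ioo (0 : ℝ) (Real.exp (-1))) :
    (∀ d : ℕ, 1 ≤ d →
      (∀ (Ω : Type*) [MeasurableSpace Ω] (P : Measure Ω) [IsProbabilityMeasure P]
          (X : ℕ → Ω → Fin d → ℝ),
          iIndepFun X P → (∀ i, HasLaw (X i) (uniformCube d) P) →
          (∀ n : ℕ, Integrable (fun ω => dispersion fun i : Fin n => X i ω) P) ∧
          IsLeast {n : ℕ | 1 ≤ n ∧ ∫ ω, dispersion (fun i : Fin n => X i ω) ∂P ≤ ε}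
            (invExpectedDispersion ε d)) ∧
      max (1 / (9 * ε) * Real.log (1 / (9 * ε))) (d / (2 * Real.exp 1 * ε))
        ≤ (invExpectedDispersion ε d : ℝ) ∧
      invExpectedDispersion ε d
        ≤ ⌈9 * (1 + Real.exp (-1)) * (d / ε) * Real.log (9 * (Real.exp 1 + 1) / ε)⌉₊) ∧
    (fun d : ℕ => (invExpectedDispersion ε d : ℝ)) =Θ[Filter.atTop] (fun d : ℕ => (d : ℝ)) := by
  have hε0 : 0 < ε := hε.1
  have hε1 : ε ≤ 1 := hε.2.le.trans (Real.exp_le_one_iff.2 (by norm_num))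
  have hlog : 0 < Real.log (9 * (Real.exp 1 + 1) / ε) :=
    Real.log_pos ((one_lt_div hε0).2 (by linarith [Real.exp_pos 1]))
  have hceil : ∀ d : ℕ, 1 ≤ d →
      1 ≤ ⌈9 * (1 + Real.exp (-1)) * (d / ε) * Real.log (9 * (Real.exp 1 + 1) / ε)⌉₊ :=
    fun d hd => Nat.ceil_pos.2 (by positivity)
  have hupper := fun d (hd : 1 ≤ d) => expectedDispersion_natCeil_le hd hε0 hε1
  have hleast := fun d hd => isLeast_invExpectedDispersion (hceil d hd) (hupper d hd)
  have hlow := fun d hd => max_le_of_expectedDispersion_le hε hd (hleast d hd).1.2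
  have hup := fun d hd => (hleast d hd).2 ⟨hceil d hd, hupper d hd⟩
  refine ⟨fun d hd => ⟨fun Ω _ P _ X hX hlaw => ⟨integrable_dispersion_of_iIndepFun hX hlaw, ?_⟩,
    hlow d hd, hup d hd⟩, ?_⟩
  · simpa only [integral_dispersion_of_iIndepFun hX hlaw] using hleast d hd
  · refine isTheta_natCast_of_le_of_le_natCeil (c := 1 / (2 * Real.exp 1 * ε))
      (C := 9 * (1 + Real.exp (-1)) / ε * Real.log (9 * (Real.exp 1 + 1) / ε)) (by positivity)
      (by positivity) ?_ ?_ <;> filter_upwards [Filter.eventually_ge_atTop 1] with d hd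
    · rw [one_div_mul_eq_div]
      exact (le_max_right _ _).trans (hlow d hd)
    · exact (hup d hd).trans_eq (by congr 1; ring)

theorem corollary1 (ε : ℝ) (hε : ε ∈ Set.Ioo (0 : ℝ) (1 / (9 * Real.exp 1))) :
    (∀ d : ℕ, 1 ≤ d →
      -- the minimum defining `N(ε,d)` is attained, and it is the same for every i.i.d. uniform
      -- sequence on every probability space
      (∀ (Ω : Type*) [MeasurableSpace Ω] (P : Measure Ω) [IsProbabilityMeasure P]
          (X : ℕ → Ω → Fin d → ℝ),
          iIndepFun X P → (∀ i, HasLaw (X i) (uniformCube d) P) →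
          (∀ n : ℕ, Integrable (fun ω => dispersion fun i : Fin n => X i ω) P) ∧
          IsLeast {n : ℕ | 1 ≤ n ∧ ∫ ω, dispersion (fun i : Fin n => X i ω) ∂P ≤ ε}
            (invExpectedDispersion ε d)) ∧
      max (1 / (9 * ε) * Real.log (1 / (9 * ε))) (d / (2 * Real.exp 1 * ε))
        ≤ (invExpectedDispersion ε d : ℝ) ∧
      invExpectedDispersion ε d
        ≤ ⌈9 * (1 + Real.exp (-1)) * (d / ε) * Real.log (9 * (Real.exp 1 + 1) / ε)⌉₊) ∧
    -- linear growth in the dimension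
    (fun d : ℕ => (invExpectedDispersion ε d : ℝ)) =Θ[Filter.atTop] (fun d : ℕ => (d : ℝ)) := by
  refine corollary1_general ε ⟨hε.1, hε.2.trans_le ?_⟩
  rw [Real.exp_neg, ← one_div]
  gcongr
  linarith [Real.exp_pos 1]
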